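/- Let $Q$ be a super-perfect group, that is, $H_1(Q)=H_2(Q)=0$, where $H_n$ denotes group homology with trivial coefficients $\mathbb{Z}$. Let $F$ be a free group and let $$1\to R\to F\xrightarrow{\;p\;} Q\to 1$$ be a short exact sequence of groups. Let $P = F\times_Q F=\{(x,y)\in F\times F \mid p(x)=p(y)\}$ be the fiber product. Then: 1. The inclusion homomorphism $P\to F\times F$ is homologically $2$-connected, that is, the induced homomorphism $H_1(P)\to H_1(F\times F)$ is an isomorphism and the induced homomorphism $H_2(P)\to H_2(F\times F)$ is surjective. 2. If $\ker\{H_2(P)\to H_2(F\times F)\}=0$, then $H_3(Q)=0$. -/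

import Mathlib

open CategoryTheory

universe u

/-- The integers as the trivial coefficient representation of `G`. Mathlib's `groupHomology` asks
for the coefficient ring to live in the universe of `G`, hence the `ULift`. -/
noncomputable abbrev trivialInt (G : Type u) [Group G] : Rep.{u} (ULift.{u} ℤ) G :=
  Rep.trivial (ULift.{u} ℤ) G (ULift.{u} ℤ)

/-- The integral homology group `Hₙ(G) = Hₙ(G; ℤ)`, with trivial action on `ℤ`. -/
noncomputable abbrev intHomology (G : Type u) [Group G] (n : ℕ) : ModuleCat.{u} (ULift.{u} ℤ) :=
  groupHomology (trivialInt G) n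

/-- The identity map of the coefficients `ℤ`, as a morphism from the trivial representation of `G`
to the restriction along `f : G → H` of the trivial representation of `H`. -/
noncomputable def trivialIntHom {G H : Type u} [Group G] [Group H] (f : G →* H) :
    trivialInt G ⟶ Rep.res f (trivialInt H) :=
  Rep.ofHom ⟨LinearMap.id, fun _ => rfl⟩

/-- The homomorphism `Hₙ(G) → Hₙ(H)` induced by a group homomorphism `f : G → H` and the identity
map of the coefficients `ℤ`. -/
noncomputable def intHomologyMap {G H : Type u} [Group G] [Group H] (f : G →* H) (n : ℕ) :
    intHomology G n ⟶ intHomology H n :=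
  groupHomology.map f (trivialIntHom f) n

/-- A group `G` is super-perfect if `H₁(G) = H₂(G) = 0`. -/
def IsSuperPerfect (G : Type u) [Group G] : Prop :=
  Subsingleton (intHomology G 1) ∧ Subsingleton (intHomology G 2)

/-- A homomorphism is homologically 2-connected if it induces an isomorphism on `H₁` and a
surjection on `H₂`. -/
def IsHomologicallyTwoConnected {G H : Type u} [Group G] [Group H] (f : G →* H) : Prop :=
  Function.Bijective (intHomologyMap f 1).hom ∧ Function.Surjective (intHomologyMap f 2).hom

/-- The fiber product `F ×_Q F = {(x, y) | p x = p y}` as a subgroup of `F × F`. -/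
def fiberProduct {F Q : Type u} [Group F] [Group Q] (p : F →* Q) : Subgroup (F × F) :=
  (p.comp (MonoidHom.fst F F)).eqLocus (p.comp (MonoidHom.snd F F))

/-! Write `R` for the kernel of `p` and `P` for the fiber product. Homology is computed with
inhomogeneous (bar) chains throughout.

On `H₁`: since `Q` is perfect, `F = R[F, F]`, so `R × R ⊆ P` already surjects onto `H₁(F × F)`.
Injectivity is Hopf's formula: `H₂(Q) = 0` gives `R ∩ [F, F] = [F, R]`, and `[F, R] × 1` lies in
`[P, P]` because `([f, r], 1) = [(f, f), (r, 1)]`.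

On `H₂`: as `H₂(F) = 0`, the group `H₂(F × F)` is generated by tori, which are bilinear and so may
be taken on elements of `R`; such tori come from `P` (`exists_mem_span_kernelTorus`).

For `H₃`: let `M` be the relation module, the kernel of `ℤ[Q]^X → ℤ[Q]`, isomorphic to the
abelianization of `R`. Dimension shifting embeds `H₃(Q)` in `H₁(Q; M)`. The difference of the Fox
derivatives of the two coordinates is a derivation `P → M`, and capping with it maps `H₂(P)` onto
`H₁(Q; M)` and kills the tori of `R`. If `H₂(P) → H₂(F × F)` is injective, these tori generate
`H₂(P)`, so `H₁(Q; M) = 0` (`subsingleton_groupHomology_relationRep`). -/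

open groupHomology Finsupp

/-! ### Group extensions from cocycles, and their splitting over free groups. -/

section CocycleExtension

variable {k G A : Type*} [CommRing k] [Group G] [AddCommGroup A] [Module k A]

/-- The set underlying the extension of `G` by `A` determined by a `2`-cocycle `c`. -/
structure CocycleExtension (ρ : Representation k G A) (c : G → G → A)
    (hc : ∀ x y z, ρ x (c y z) + c x (y * z) = c x y + c (x * y) z) where
  /-- The coordinate in the kernel. -/
  left : A
  /-- The image in the quotient group. -/
  right : G

namespace CocycleExtension

variable {ρ : Representation k G A} {c : G → G → A}
  {hc : ∀ x y z, ρ x (c y z) + c x (y * z) = c x y + c (x * y) z}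

@[ext]
theorem ext' {x y : CocycleExtension ρ c hc} (hl : x.left = y.left) (hr : x.right = y.right) :
    x = y := by
  cases x; cases y; simp_all

instance : Mul (CocycleExtension ρ c hc) :=
  ⟨fun x y => ⟨x.left + ρ x.right y.left + c x.right y.right, x.right * y.right⟩⟩

/-- Cocycles are not assumed normalized, hence the correction `-c 1 1`. -/
instance : One (CocycleExtension ρ c hc) := ⟨⟨-c 1 1, 1⟩⟩

instance : Inv (CocycleExtension ρ c hc) :=
  ⟨fun x => ⟨-c 1 1 - ρ x.right⁻¹ x.left - c x.right⁻¹ x.right, x.right⁻¹⟩⟩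

@[simp] theorem mul_left' (x y : CocycleExtension ρ c hc) :
    (x * y).left = x.left + ρ x.right y.left + c x.right y.right := rfl

@[simp] theorem mul_right' (x y : CocycleExtension ρ c hc) :
    (x * y).right = x.right * y.right := rfl

@[simp] theorem one_left : (1 : CocycleExtension ρ c hc).left = -c 1 1 := rfl

@[simp] theorem one_right : (1 : CocycleExtension ρ c hc).right = 1 := rfl

@[simp] theorem inv_left (x : CocycleExtension ρ c hc) :
    x⁻¹.left = -c 1 1 - ρ x.right⁻¹ x.left - c x.right⁻¹ x.right := rfl

@[simp] theorem inv_right (x : CocycleExtension ρ c hc) : x⁻¹.right = x.right⁻¹ := rfl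

instance : Group (CocycleExtension ρ c hc) :=
  Group.ofLeftAxioms
    (fun x y z => by
      ext
      · have := hc x.right y.right z.right
        simp only [mul_left', mul_right', map_add, map_mul, Module.End.mul_apply]
        have h2 : c (x.right * y.right) z.right = ρ x.right (c y.right z.right)
          + c x.right (y.right * z.right) - c x.right y.right := by
          rw [this]; abel
        rw [h2]; abel
      · exact mul_assoc _ _ _)
    (fun x => by
      ext
      · have := hc 1 1 x.right
        simp only [map_one, Module.End.one_apply, one_mul] at this
        simp only [mul_left', one_left, one_right, map_one, Module.End.one_apply]
        have h2 : c 1 x.right = c 1 1 := by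
          exact add_right_cancel this
        rw [h2]; abel
      · exact one_mul _)
    (fun x => by
      ext
      · simp only [mul_left', inv_left, inv_right, one_left]
        abel
      · exact inv_mul_cancel _)

/-- The projection of the extension onto the quotient group. -/
def rightHom : CocycleExtension ρ c hc →* G where
  toFun := right
  map_one' := rfl
  map_mul' _ _ := rfl

end CocycleExtension

/-- Over a free group every `2`-cocycle is a coboundary, and the cochain which it bounds may be
prescribed on the free generators. -/
theorem IsFreeGroup.exists_cochain [IsFreeGroup G] (ρ : Representation k G A) (c : G → G → A)
    (hc : ∀ x y z, ρ x (c y z) + c x (y * z) = c x y + c (x * y) z)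
    (a : IsFreeGroup.Generators G → A) :
    ∃ b : G → A, (∀ i, b (IsFreeGroup.of i) = a i) ∧
      ∀ x y, b (x * y) = b x + ρ x (b y) + c x y := by
  -- Freeness splits the extension, with any chosen lifts of the generators; the kernel coordinate
  -- of the splitting is the cochain.
  let s : G →* CocycleExtension ρ c hc := IsFreeGroup.lift fun i => ⟨a i, IsFreeGroup.of i⟩
  have hs : CocycleExtension.rightHom.comp s = MonoidHom.id G := by
    refine IsFreeGroup.ext_hom fun i => ?_
    simp [s, CocycleExtension.rightHom]
  have hs' : ∀ x, (s x).right = x := fun x => DFunLike.congr_fun hs x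
  refine ⟨fun x => (s x).left, fun i => by simp [s], fun x y => ?_⟩
  simp [hs']

end CocycleExtension

theorem IsFreeGroup.closure_range_of (G : Type*) [Group G] [IsFreeGroup G] :
    Subgroup.closure (Set.range (IsFreeGroup.of : IsFreeGroup.Generators G → G)) = ⊤ := by
  set S := Subgroup.closure (Set.range (IsFreeGroup.of : IsFreeGroup.Generators G → G))
  let s : G →* S :=
    IsFreeGroup.lift fun i => ⟨IsFreeGroup.of i, Subgroup.subset_closure ⟨i, rfl⟩⟩
  have hs : S.subtype.comp s = MonoidHom.id G := IsFreeGroup.ext_hom fun i => by simp [s]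
  refine eq_top_iff.2 fun x _ => ?_
  have := DFunLike.congr_fun hs x
  simp only [MonoidHom.comp_apply, MonoidHom.id_apply] at this
  exact this ▸ (s x).2

/-! ### Bar chains with trivial coefficients, and chains of a product. -/

section TrivialChains

variable {k G H : Type u} [CommRing k] [Group G] [Group H]

variable (k G) in
/-- The trivial representation of `G` on the coefficient ring. -/
noncomputable abbrev trivialRep : Rep.{u} k G := Rep.trivial k G k

variable (k G) in
/-- The boundary from `2`-chains to `1`-chains with trivial coefficients. -/
noncomputable abbrev bd₂₁ : (G × G →₀ k) →ₗ[k] (G →₀ k) := (d₂₁ (trivialRep k G)).hom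

variable (k G) in
/-- The boundary from `3`-chains to `2`-chains with trivial coefficients. -/
noncomputable abbrev bd₃₂ : (G × G × G →₀ k) →ₗ[k] (G × G →₀ k) := (d₃₂ (trivialRep k G)).hom

theorem bd₂₁_single (g h : G) (a : k) :
    bd₂₁ k G (single (g, h) a) = single h a - single (g * h) a + single g a :=
  d₂₁_single (A := trivialRep k G) (g, h) a

theorem bd₃₂_single (x y z : G) (a : k) :
    bd₃₂ k G (single (x, y, z) a) =
      single (y, z) a - single (x * y, z) a + single (x, y * z) a - single (x, y) a :=
  d₃₂_single (A := trivialRep k G) (x, y, z) a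

theorem bd₂₁_mapDomain (f : G →* H) (c : G × G →₀ k) :
    bd₂₁ k H (lmapDomain k k (Prod.map f f) c) = lmapDomain k k f (bd₂₁ k G c) := by
  induction c using Finsupp.induction_linear with
  | zero => simp
  | add x y hx hy => simp only [map_add, hx, hy]
  | single g a =>
    obtain ⟨g, h⟩ := g
    simp only [bd₂₁_single, map_add, map_sub, lmapDomain_apply, mapDomain_single, Prod.map,
      map_mul]

theorem bd₃₂_mapDomain (f : G →* H) (c : G × G × G →₀ k) :
    bd₃₂ k H (lmapDomain k k (Prod.map f (Prod.map f f)) c) =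
      lmapDomain k k (Prod.map f f) (bd₃₂ k G c) := by
  induction c using Finsupp.induction_linear with
  | zero => simp
  | add x y hx hy => simp only [map_add, hx, hy]
  | single g a =>
    obtain ⟨g, h, l⟩ := g
    simp only [bd₃₂_single, map_add, map_sub, lmapDomain_apply, mapDomain_single, Prod.map,
      map_mul]

theorem mapDomain_mem_cycles₂ (f : G →* H) {c : G × G →₀ k}
    (hc : c ∈ cycles₂ (trivialRep k G)) :
    lmapDomain k k (Prod.map f f) c ∈ cycles₂ (trivialRep k H) := by
  change bd₂₁ k H _ = 0
  rw [bd₂₁_mapDomain, show bd₂₁ k G c = 0 from hc, map_zero]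

theorem mapDomain_mem_boundaries₂ (f : G →* H) {c : G × G →₀ k}
    (hc : c ∈ boundaries₂ (trivialRep k G)) :
    lmapDomain k k (Prod.map f f) c ∈ boundaries₂ (trivialRep k H) := by
  obtain ⟨e, rfl⟩ := hc
  exact ⟨_, bd₃₂_mapDomain f e⟩

variable (k G) in
/-- Inhomogeneous `2`-chains modulo boundaries. -/
abbrev Opcycles₂ : Type u := (G × G →₀ k) ⧸ boundaries₂ (trivialRep k G)

variable (k G) in
/-- The projection of the `2`-chains onto their quotient by the boundaries. -/
noncomputable abbrev toOpcycles₂ : (G × G →₀ k) →ₗ[k] Opcycles₂ k G :=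
  (boundaries₂ (trivialRep k G)).mkQ

theorem toOpcycles₂_eq_zero_iff {c : G × G →₀ k} :
    toOpcycles₂ k G c = 0 ↔ c ∈ boundaries₂ (trivialRep k G) :=
  Submodule.Quotient.mk_eq_zero _

/-- The class `[g|h]` of a generator of the `2`-chains modulo boundaries. -/
noncomputable def barClass (k : Type u) [CommRing k] (g h : G) : Opcycles₂ k G :=
  toOpcycles₂ k G (single (g, h) 1)

theorem toOpcycles₂_single (g h : G) (a : k) :
    toOpcycles₂ k G (single (g, h) a) = a • barClass k g h := by
  rw [barClass, ← map_smul, smul_single, smul_eq_mul, mul_one]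

/-- The relation imposed by the boundary of `[x|y|z]`: `barClass` is a `2`-cocycle, the universal
one. -/
theorem barClass_cocycle (x y z : G) :
    barClass k y z + barClass k x (y * z) = barClass k x y + barClass k (x * y) z := by
  have h : toOpcycles₂ k G (bd₃₂ k G (single (x, y, z) 1)) = 0 :=
    toOpcycles₂_eq_zero_iff.2 ⟨_, rfl⟩
  rw [bd₃₂_single, map_sub, map_add, map_sub] at h
  simp only [toOpcycles₂_single, one_smul] at h
  rw [← sub_eq_zero, ← h]
  abel

/-- The map induced by a homomorphism on `2`-chains modulo boundaries. -/
noncomputable def mapOpcycles₂ (k : Type u) [CommRing k] (f : G →* H) :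
    Opcycles₂ k G →ₗ[k] Opcycles₂ k H :=
  Submodule.mapQ _ _ (lmapDomain k k (Prod.map f f)) fun _ hc => mapDomain_mem_boundaries₂ f hc

theorem mapOpcycles₂_toOpcycles₂ (f : G →* H) (c : G × G →₀ k) :
    mapOpcycles₂ k f (toOpcycles₂ k G c) = toOpcycles₂ k H (lmapDomain k k (Prod.map f f) c) := rfl

@[simp]
theorem mapOpcycles₂_barClass (f : G →* H) (x y : G) :
    mapOpcycles₂ k f (barClass k x y) = barClass k (f x) (f y) := by
  rw [barClass, mapOpcycles₂_toOpcycles₂, lmapDomain_apply, mapDomain_single]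
  rfl

/-- The second homology of a free group vanishes. -/
theorem cycles₂_le_boundaries₂_of_isFreeGroup [IsFreeGroup G] :
    cycles₂ (trivialRep k G) ≤ boundaries₂ (trivialRep k G) := by
  intro c hc
  obtain ⟨b, -, hb⟩ := IsFreeGroup.exists_cochain (Representation.trivial k G (Opcycles₂ k G))
    (barClass k) (fun x y z => barClass_cocycle x y z) (fun _ => 0)
  -- A cochain bounding the universal cocycle factors the projection modulo boundaries through
  -- `bd₂₁`, so cycles go to zero.
  have h : toOpcycles₂ k G = -(linearCombination k b ∘ₗ bd₂₁ k G) := by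
    refine lhom_ext fun ⟨x, y⟩ a => ?_
    rw [toOpcycles₂_single, LinearMap.neg_apply, LinearMap.comp_apply, bd₂₁_single]
    simp only [map_add, map_sub, linearCombination_single, hb, Representation.trivial_apply,
      smul_add]
    abel
  rw [← toOpcycles₂_eq_zero_iff, h, LinearMap.neg_apply, LinearMap.comp_apply,
    show bd₂₁ k G c = 0 from hc, map_zero, neg_zero]

/-- For commuting `x` and `y`, the class of the `2`-cycle `[x|y] - [y|x]`. -/
noncomputable def torusClass (k : Type u) [CommRing k] (x y : G) : Opcycles₂ k G :=
  barClass k x y - barClass k y x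

theorem torusClass_neg (x y : G) : torusClass k y x = -torusClass k x y := by
  rw [torusClass, torusClass, neg_sub]

@[simp]
theorem mapOpcycles₂_torusClass (f : G →* H) (x y : G) :
    mapOpcycles₂ k f (torusClass k x y) = torusClass k (f x) (f y) := by
  simp [torusClass]

/-- The shuffle `[x|x'|y] - [x|y|x'] + [y|x|x']` bounds the difference. -/
theorem torusClass_mul_left {x x' y : G} (h : Commute x y) (h' : Commute x' y) :
    torusClass k (x * x') y = torusClass k x y + torusClass k x' y := by
  have e₁ := barClass_cocycle (k := k) x x' y
  have e₂ := barClass_cocycle (k := k) x y x'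
  have e₃ := barClass_cocycle (k := k) y x x'
  rw [← h'.eq, h.eq] at e₂
  unfold torusClass
  linear_combination (norm := module) -e₁ + e₂ - e₃

/-- Up to boundaries, a `2`-chain of a product group differs from the sum of its projections to
the factors by tori and a term depending only on its boundary. -/
theorem toOpcycles₂_prod (c : (G × H) × (G × H) →₀ k) :
    toOpcycles₂ k (G × H) c =
      mapOpcycles₂ k ((MonoidHom.inl G H).comp (MonoidHom.fst G H)) (toOpcycles₂ k _ c) +
      mapOpcycles₂ k ((MonoidHom.inr G H).comp (MonoidHom.snd G H)) (toOpcycles₂ k _ c) -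
      linearCombination k (fun x : (G × H) × (G × H) =>
        torusClass k ((x.2.1, 1) : G × H) (1, x.1.2)) c -
      linearCombination k (fun x : G × H => barClass k ((x.1, 1) : G × H) (1, x.2))
        (bd₂₁ k (G × H) c) := by
  induction c using Finsupp.induction_linear with
  | zero => simp
  | add x y hx hy =>
    simp only [map_add]
    linear_combination (norm := module) hx + hy
  | single x a =>
    obtain ⟨⟨g, h⟩, g', h'⟩ := x
    simp only [toOpcycles₂_single, bd₂₁_single, map_smul, mapOpcycles₂_barClass, map_add, map_sub,
      linearCombination_single, MonoidHom.comp_apply, MonoidHom.coe_fst, MonoidHom.coe_snd,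
      MonoidHom.inl_apply, MonoidHom.inr_apply, Prod.mk_mul_mk, torusClass]
    -- These relations regroup the product `g·h·g'·h'` into `g·g'·h·h'`; exchanging `h` and `g'`
    -- produces the torus.
    have e₁ := barClass_cocycle (k := k) ((g, 1) : G × H) (1, h) (g', h')
    have e₂ := barClass_cocycle (k := k) ((1, h) : G × H) (g', 1) (1, h')
    have e₃ := barClass_cocycle (k := k) ((g', 1) : G × H) (1, h) (1, h')
    have e₄ := barClass_cocycle (k := k) ((g, 1) : G × H) (g', 1) (1, h * h')
    simp only [Prod.mk_mul_mk, one_mul, mul_one] at e₁ e₂ e₃ e₄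
    linear_combination (norm := module) a • (-e₁ + e₂ - e₃ + e₄)

end TrivialChains

/-! ### Tori generate the second homology of a product. -/

section Tori

variable {k G H : Type u} [CommRing k] [Group G] [Group H]

/-- If `H₂(G) = H₂(H) = 0`, then `H₂(G × H)` is generated by tori. -/
theorem toOpcycles₂_mem_span_torusClass
    (hG : cycles₂ (trivialRep k G) ≤ boundaries₂ (trivialRep k G))
    (hH : cycles₂ (trivialRep k H) ≤ boundaries₂ (trivialRep k H))
    {c : (G × H) × (G × H) →₀ k} (hc : c ∈ cycles₂ (trivialRep k (G × H))) :
    toOpcycles₂ k (G × H) c ∈ Submodule.span k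
      (Set.range fun x : G × H => torusClass k ((x.1, 1) : G × H) (1, x.2)) := by
  have hl : mapOpcycles₂ k ((MonoidHom.inl G H).comp (MonoidHom.fst G H))
      (toOpcycles₂ k _ c) = 0 := by
    rw [mapOpcycles₂_toOpcycles₂, toOpcycles₂_eq_zero_iff]
    have h := mapDomain_mem_boundaries₂ (MonoidHom.inl G H)
      (hG (mapDomain_mem_cycles₂ (MonoidHom.fst G H) hc))
    rw [← LinearMap.comp_apply, ← lmapDomain_comp] at h
    exact h
  have hr : mapOpcycles₂ k ((MonoidHom.inr G H).comp (MonoidHom.snd G H))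
      (toOpcycles₂ k _ c) = 0 := by
    rw [mapOpcycles₂_toOpcycles₂, toOpcycles₂_eq_zero_iff]
    have h := mapDomain_mem_boundaries₂ (MonoidHom.inr G H)
      (hH (mapDomain_mem_cycles₂ (MonoidHom.snd G H) hc))
    rw [← LinearMap.comp_apply, ← lmapDomain_comp] at h
    exact h
  rw [toOpcycles₂_prod, hl, hr, show bd₂₁ k (G × H) c = 0 from hc, map_zero, sub_zero, add_zero,
    zero_sub, linearCombination_apply]
  refine Submodule.neg_mem _ (Submodule.finsuppSum_mem _ _ _ _ fun x _ => ?_)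
  exact Submodule.smul_mem _ _ (Submodule.subset_span ⟨(x.2.1, x.1.2), rfl⟩)

/-- The torus is a homomorphism in `g` to an abelian group, so it factors through the
abelianization. -/
theorem torusClass_eq_of_mul_inv_mem_commutator_left {g s : G} (h : H)
    (hs : g * s⁻¹ ∈ commutator G) :
    torusClass k ((g, 1) : G × H) (1, h) = torusClass k ((s, 1) : G × H) (1, h) := by
  have hcomm (x : G) : Commute ((x, 1) : G × H) (1, h) := by
    simp [Commute, SemiconjBy]
  let φ : G →* Multiplicative (Opcycles₂ k (G × H)) := MonoidHom.mk'
    (fun x => .ofAdd (torusClass k ((x, 1) : G × H) (1, h))) fun x y => by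
      rw [← ofAdd_add, ← torusClass_mul_left (hcomm x) (hcomm y), Prod.mk_mul_mk, one_mul]
  have := Abelianization.commutator_subset_ker φ hs
  rw [MonoidHom.mem_ker, map_mul, map_inv, mul_inv_eq_one] at this
  exact Multiplicative.ofAdd.injective this

theorem torusClass_eq_of_mul_inv_mem_commutator_right (g : G) {h t : H}
    (ht : h * t⁻¹ ∈ commutator H) :
    torusClass k ((g, 1) : G × H) (1, h) = torusClass k ((g, 1) : G × H) (1, t) := by
  have := torusClass_eq_of_mul_inv_mem_commutator_left (k := k) g ht
  have := congrArg (mapOpcycles₂ k (MulEquiv.prodComm (M := H) (N := G)).toMonoidHom) this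
  simp only [mapOpcycles₂_torusClass] at this
  rw [torusClass_neg, torusClass_neg ((1, t) : G × H)]
  exact congrArg _ this

end Tori

/-! ### First homology and the abelianization. -/

section FirstClass

variable (k : Type u) {G : Type u} [CommRing k] [Group G]

/-- The class in `H₁` of an element of a group. -/
noncomputable def firstClass (g : G) :
    (G →₀ k) ⧸ boundaries₁ (trivialRep k G) :=
  (boundaries₁ (trivialRep k G)).mkQ (single g 1)

theorem firstClass_mul (x y : G) :
    firstClass k (x * y) = firstClass k x + firstClass k y := by
  rw [firstClass, firstClass, firstClass, ← map_add, ← sub_eq_zero, ← map_sub]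
  refine (Submodule.Quotient.mk_eq_zero _).2 ⟨-single (x, y) 1, ?_⟩
  rw [map_neg]
  exact (congrArg _ (bd₂₁_single x y (1 : k))).trans (by abel)

theorem firstClass_one : firstClass k (1 : G) = 0 := by
  have := firstClass_mul k (1 : G) 1
  rwa [mul_one, left_eq_add] at this

theorem firstClass_inv (x : G) :
    firstClass k x⁻¹ = -firstClass k x := by
  rw [eq_neg_iff_add_eq_zero, ← firstClass_mul, inv_mul_cancel, firstClass_one]

end FirstClass

section Abelianization

variable {G : Type u} [Group G]

/-- The map from integral `1`-chains to the abelianization. -/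
noncomputable def chainsToAbelianization (G : Type u) [Group G] :
    (G →₀ ULift.{u} ℤ) →ₗ[ULift.{u} ℤ] Additive (Abelianization G) :=
  linearCombination _ fun g => .ofMul (Abelianization.of g)

theorem chainsToAbelianization_single (g : G) (a : ULift.{u} ℤ) :
    chainsToAbelianization G (single g a) = a.down • .ofMul (Abelianization.of g) := by
  rw [chainsToAbelianization, linearCombination_single]
  rfl

/-- For the converse, `firstClass` is a homomorphism to an abelian group, so the projection modulo
boundaries factors through `chainsToAbelianization`. -/
theorem mem_boundaries₁_iff {c : G →₀ ULift.{u} ℤ} :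
    c ∈ boundaries₁ (trivialInt G) ↔ chainsToAbelianization G c = 0 := by
  constructor
  · rintro ⟨e, rfl⟩
    have : chainsToAbelianization G ∘ₗ bd₂₁ (ULift.{u} ℤ) G = 0 := by
      refine lhom_ext fun ⟨x, y⟩ a => ?_
      rw [LinearMap.comp_apply, bd₂₁_single]
      simp only [map_add, map_sub, chainsToAbelianization_single, map_mul, ofMul_mul, smul_add,
        LinearMap.zero_apply]
      abel
    exact LinearMap.congr_fun this e
  · intro hc
    let B := boundaries₁ (trivialInt G)
    let φ : G →* Multiplicative ((G →₀ ULift.{u} ℤ) ⧸ B) :=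
      MonoidHom.mk' (fun x => .ofAdd (firstClass _ x)) fun x y => firstClass_mul _ x y
    let η : Additive (Abelianization G) →+ ((G →₀ ULift.{u} ℤ) ⧸ B) :=
      (Abelianization.lift φ).toAdditiveLeft
    have : η.comp (chainsToAbelianization G).toAddMonoidHom = B.mkQ.toAddMonoidHom := by
      refine addHom_ext fun g a => ?_
      change η (chainsToAbelianization G (single g a)) = B.mkQ (single g a)
      rw [chainsToAbelianization_single, map_zsmul]
      change a.down • B.mkQ (single g 1) = _
      rw [← map_zsmul, smul_single]
      congr 2
      ext
      simp
    have h2 := DFunLike.congr_fun this c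
    change η (chainsToAbelianization G c) = B.mkQ c at h2
    rw [hc, map_zero] at h2
    exact (Submodule.Quotient.mk_eq_zero _).1 h2.symm

theorem single_one_mem_boundaries₁_iff {g : G} :
    single g 1 ∈ boundaries₁ (trivialInt G) ↔ g ∈ commutator G := by
  rw [mem_boundaries₁_iff, chainsToAbelianization_single]
  change (1 : ℤ) • _ = _ ↔ _
  rw [one_smul, ofMul_eq_zero, ← MonoidHom.mem_ker, Abelianization.ker_of]

end Abelianization

/-! ### Hopf's formula when `H₂(Q) = 0`. -/

section Hopf

variable {F Q : Type u} [Group F] [Group Q]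

theorem mk_mem_center_of_mem_ker (p : F →* Q) {r : F} (hr : r ∈ p.ker) :
    (r : F ⧸ ⁅(⊤ : Subgroup F), p.ker⁆) ∈ Subgroup.center (F ⧸ ⁅(⊤ : Subgroup F), p.ker⁆) := by
  rw [Subgroup.mem_center_iff]
  intro x
  induction x using QuotientGroup.induction_on with
  | H x =>
    rw [← QuotientGroup.mk_mul, ← QuotientGroup.mk_mul, QuotientGroup.eq, Subgroup.commutator_comm]
    convert Subgroup.commutator_mem_commutator (inv_mem hr) (Subgroup.mem_top x⁻¹) using 1
    rw [commutatorElement_def]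
    group

/-- For a surjection `p : F → Q` with `H₂(Q) = 0`, an element of the kernel which is a product of
commutators lies in `[F, ker p]`. -/
theorem mem_commutator_ker_of_mem_commutator (p : F →* Q) (hp : Function.Surjective p)
    (hQ : cycles₂ (trivialInt Q) ≤ boundaries₂ (trivialInt Q)) {r : F} (hr : r ∈ p.ker)
    (hr' : r ∈ commutator F) : r ∈ ⁅(⊤ : Subgroup F), p.ker⁆ := by
  let N : Subgroup F := ⁅(⊤ : Subgroup F), p.ker⁆
  let C := Subgroup.center (F ⧸ N)
  let : CommGroup C := { (inferInstance : Group C) with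
    mul_comm := fun a b => Subtype.ext (Subgroup.mem_center_iff.1 b.2 a) }
  let s : Q → F := Function.surjInv hp
  have hs (q : Q) : p (s q) = q := Function.surjInv_eq hp q
  have hker (x : F) : x * (s (p x))⁻¹ ∈ p.ker := by simp [MonoidHom.mem_ker, hs]
  let m : p.ker →* C := ((QuotientGroup.mk' N).comp p.ker.subtype).codRestrict C
    fun r => mk_mem_center_of_mem_ker p r.2
  have hm (x : F) (r : p.ker) (h : x * r * x⁻¹ ∈ p.ker) : m ⟨x * r * x⁻¹, h⟩ = m r := by
    refine Subtype.ext ?_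
    change (((x * r * x⁻¹ : F)) : F ⧸ N) = (r : F)
    rw [QuotientGroup.mk_mul, QuotientGroup.mk_mul,
      Subgroup.mem_center_iff.1 (mk_mem_center_of_mem_ker p r.2) x, mul_assoc,
      ← QuotientGroup.mk_mul, mul_inv_cancel, QuotientGroup.mk_one, mul_one]
  -- `w` measures how far `x` is from the section, in the central image of the kernel in `F ⧸ [F,
  -- ker p]`.
  let w : F → C := fun x => m ⟨_, hker x⟩
  have hw (r : p.ker) (x : F) : w (r * x) = m r * w x := by
    rw [← map_mul]
    refine congrArg m (Subtype.ext ?_)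
    change r * x * (s (p (r * x)))⁻¹ = r * (x * (s (p x))⁻¹)
    rw [map_mul, show p r = 1 from r.2, one_mul, mul_assoc]
  let v : Q × Q → Additive C := fun q =>
    .ofMul (w (s q.2)) - .ofMul (w (s q.1 * s q.2)) + .ofMul (w (s q.1))
  -- By centrality, the coboundary of `w` depends only on the images in `Q`.
  have hv (x y : F) : .ofMul (w y) - .ofMul (w (x * y)) + .ofMul (w x) = v (p x, p y) := by
    have hx := hw ⟨_, hker x⟩ (s (p x))
    have hy := hw ⟨_, hker y⟩ (s (p y))
    have hc : s (p x) * (y * (s (p y))⁻¹) * (s (p x))⁻¹ ∈ p.ker := by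
      simp [MonoidHom.mem_ker, hs]
    have hxy := hw (⟨_, hker x⟩ * ⟨_, hc⟩) (s (p x) * s (p y))
    rw [map_mul, hm (s (p x)) ⟨_, hker y⟩] at hxy
    simp only [inv_mul_cancel_right] at hx hy
    have e : ((⟨_, hker x⟩ * ⟨_, hc⟩ : p.ker) : F) * (s (p x) * s (p y)) = x * y := by
      change x * (s (p x))⁻¹ * (s (p x) * (y * (s (p y))⁻¹) * (s (p x))⁻¹) *
        (s (p x) * s (p y)) = x * y
      group
    rw [e] at hxy
    simp only [v]
    rw [hx, hy, hxy, ofMul_mul, ofMul_mul, ofMul_mul, ofMul_mul]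
    abel
  let U : (F →₀ ULift.{u} ℤ) →ₗ[ULift.{u} ℤ] Additive C :=
    linearCombination _ fun x => .ofMul (w x)
  let V : (Q × Q →₀ ULift.{u} ℤ) →ₗ[ULift.{u} ℤ] Additive C := linearCombination _ v
  let p₂ := lmapDomain (ULift.{u} ℤ) (ULift.{u} ℤ) (Prod.map p p)
  have hUV (c : F × F →₀ ULift.{u} ℤ) : U (bd₂₁ (ULift.{u} ℤ) F c) = V (p₂ c) := by
    have : U ∘ₗ bd₂₁ (ULift.{u} ℤ) F = V ∘ₗ p₂ := by
      refine lhom_ext fun ⟨x, y⟩ a => ?_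
      rw [LinearMap.comp_apply, LinearMap.comp_apply, bd₂₁_single, lmapDomain_apply,
        mapDomain_single]
      simp only [U, V, map_add, map_sub, linearCombination_single, Prod.map]
      rw [← hv, smul_add, smul_sub]
    exact LinearMap.congr_fun this c
  obtain ⟨c, hc⟩ := single_one_mem_boundaries₁_iff.2 hr'
  change bd₂₁ (ULift.{u} ℤ) F c = _ at hc
  -- Here `c` bounds `[r]`, whose image is `[1]`, and `[1|1]` also bounds `[1]`; subtracting it
  -- leaves a cycle.
  have hcyc : p₂ (c - single (1, 1) 1) ∈ cycles₂ (trivialInt Q) := by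
    change bd₂₁ (ULift.{u} ℤ) Q _ = 0
    rw [bd₂₁_mapDomain, map_sub, hc, bd₂₁_single, map_sub, map_add, map_sub]
    simp only [lmapDomain_apply, mapDomain_single, mul_one, show p r = 1 from hr, map_one]
    abel
  obtain ⟨e, he⟩ := hQ hcyc
  -- With the `3`-chain lifted to `F`, `V` of its boundary becomes `U` of a double boundary, which
  -- is zero. What remains is `w r = w 1`.
  obtain ⟨e, rfl⟩ := mapDomain_surjective (hp.prodMap (hp.prodMap hp)) e
  have he' : V (p₂ (c - single (1, 1) 1)) = 0 := by
    rw [← he]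
    refine (congrArg V (bd₃₂_mapDomain p e)).trans ?_
    rw [← hUV]
    exact (congrArg U (LinearMap.congr_fun
      (congrArg ModuleCat.Hom.hom (d₃₂_comp_d₂₁ (trivialInt F))) e)).trans (map_zero U)
  rw [← hUV, map_sub, hc, bd₂₁_single, map_sub, map_add, map_sub] at he'
  simp only [U, linearCombination_single, one_smul, mul_one, sub_self, zero_add] at he'
  rw [sub_eq_zero] at he'
  have hone : w r = w 1 := Additive.ofMul.injective he'
  have h2 := hw ⟨r, hr⟩ 1
  simp only [mul_one, hone] at h2
  have h3 : m ⟨r, hr⟩ = 1 := right_eq_mul.1 h2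
  exact (QuotientGroup.eq_one_iff r).1 (congrArg Subtype.val h3)

end Hopf

/-! ### Induced maps on `H₁` and `H₂` in terms of chains. -/

section IntHomology

variable {G H : Type u} [Group G] [Group H]

theorem intHomologyMap_H1π (f : G →* H) (x : cycles₁ (trivialInt G)) :
    ∃ hx, (intHomologyMap f 1).hom (H1π (trivialInt G) x) = H1π (trivialInt H)
      ⟨lmapDomain (ULift.{u} ℤ) (ULift.{u} ℤ) f x.1, hx⟩ := by
  have h := LinearMap.congr_fun (congrArg ModuleCat.Hom.hom
    (H1π_comp_map (A := trivialInt G) (B := trivialInt H) f (trivialIntHom f))) x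
  have e : (mapCycles₁ f (trivialIntHom f) x).1 =
      lmapDomain (ULift.{u} ℤ) (ULift.{u} ℤ) f x.1 := by
    rw [coe_mapCycles₁]
    exact mapRange_id _
  refine ⟨e ▸ (mapCycles₁ f (trivialIntHom f) x).2, h.trans ?_⟩
  exact congrArg (H1π (trivialInt H)).hom (Subtype.ext e)

theorem intHomologyMap_H2π (f : G →* H) (x : cycles₂ (trivialInt G)) :
    (intHomologyMap f 2).hom (H2π (trivialInt G) x) = H2π (trivialInt H)
      ⟨lmapDomain (ULift.{u} ℤ) (ULift.{u} ℤ) (Prod.map f f) x.1,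
        mapDomain_mem_cycles₂ f x.2⟩ := by
  have h := LinearMap.congr_fun (congrArg ModuleCat.Hom.hom
    (H2π_comp_map (A := trivialInt G) (B := trivialInt H) f (trivialIntHom f))) x
  have e : (mapCycles₂ f (trivialIntHom f) x).1 =
      lmapDomain (ULift.{u} ℤ) (ULift.{u} ℤ) (Prod.map f f) x.1 := by
    rw [coe_mapCycles₂]
    exact mapRange_id _
  exact h.trans (congrArg (H2π (trivialInt H)).hom (Subtype.ext e))

theorem H1π_surjective {k G : Type u} [CommRing k] [Group G] (A : Rep.{u} k G) :
    Function.Surjective (H1π A).hom :=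
  (ModuleCat.epi_iff_surjective _).1 inferInstance

theorem H2π_surjective {k G : Type u} [CommRing k] [Group G] (A : Rep.{u} k G) :
    Function.Surjective (H2π A).hom :=
  (ModuleCat.epi_iff_surjective _).1 inferInstance

theorem cycles₂_le_boundaries₂_of_subsingleton {k G : Type u} [CommRing k] [Group G]
    (A : Rep.{u} k G) (h : Subsingleton (groupHomology A 2)) : cycles₂ A ≤ boundaries₂ A :=
  fun c hc => (H2π_eq_zero_iff ⟨c, hc⟩).1 (Subsingleton.elim _ _)

theorem mem_cycles₁_trivialInt (x : G →₀ ULift.{u} ℤ) : x ∈ cycles₁ (trivialInt G) := by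
  rw [cycles₁_eq_top_of_isTrivial]
  trivial

theorem commutator_eq_top_of_subsingleton (h : Subsingleton (intHomology G 1)) :
    commutator G = ⊤ :=
  eq_top_iff.2 fun g _ => single_one_mem_boundaries₁_iff.1 <|
    (H1π_eq_zero_iff ⟨single g 1, mem_cycles₁_trivialInt _⟩).1 (Subsingleton.elim _ _)

theorem chainsToAbelianization_lmapDomain (f : G →* H) (x : G →₀ ULift.{u} ℤ) :
    chainsToAbelianization H (lmapDomain (ULift.{u} ℤ) (ULift.{u} ℤ) f x) =
      (Abelianization.map f).toAdditive (chainsToAbelianization G x) := by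
  induction x using Finsupp.induction_linear with
  | zero => simp
  | add x y hx hy => simp only [map_add, hx, hy]
  | single g a =>
    rw [lmapDomain_apply, mapDomain_single, chainsToAbelianization_single,
      chainsToAbelianization_single, map_zsmul]
    rfl

theorem intHomologyMap_one_injective (f : G →* H)
    (hf : ∀ x, f x ∈ commutator H → x ∈ commutator G) :
    Function.Injective (intHomologyMap f 1).hom := by
  rw [injective_iff_map_eq_zero]
  intro z hz
  obtain ⟨x, rfl⟩ := H1π_surjective _ z
  obtain ⟨hx, e⟩ := intHomologyMap_H1π f x
  rw [e] at hz
  have h := mem_boundaries₁_iff.1 ((H1π_eq_zero_iff _).1 hz)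
  refine (H1π_eq_zero_iff _).2 (mem_boundaries₁_iff.2 ?_)
  rw [chainsToAbelianization_lmapDomain] at h
  generalize chainsToAbelianization G x.1 = y at h
  induction y using Quotient.inductionOn with
  | h y =>
    change (Abelianization.of (f y) : Abelianization H) = 1 at h
    rw [← MonoidHom.mem_ker, Abelianization.ker_of] at h
    change (Abelianization.of y : Abelianization G) = 1
    rw [← MonoidHom.mem_ker, Abelianization.ker_of]
    exact hf y h

theorem intHomologyMap_one_surjective (f : G →* H)
    (hf : ∀ y, ∃ x, y * (f x)⁻¹ ∈ commutator H) :
    Function.Surjective (intHomologyMap f 1).hom := by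
  intro z
  obtain ⟨y, rfl⟩ := H1π_surjective _ z
  obtain ⟨y', hy'⟩ := QuotientGroup.mk_surjective (chainsToAbelianization H y.1).toMul
  obtain ⟨x, hx⟩ := hf y'
  refine ⟨H1π (trivialInt G) ⟨single x 1, mem_cycles₁_trivialInt _⟩, ?_⟩
  obtain ⟨hx', e⟩ := intHomologyMap_H1π f ⟨single x 1, mem_cycles₁_trivialInt _⟩
  rw [e, H1π_eq_iff]
  refine mem_boundaries₁_iff.2 ?_
  change chainsToAbelianization H (lmapDomain (ULift.{u} ℤ) (ULift.{u} ℤ) f (single x 1) - y.1) = 0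
  rw [map_sub, lmapDomain_apply, mapDomain_single, sub_eq_zero, eq_comm]
  have h1 : chainsToAbelianization H (single (f x) 1) = .ofMul (Abelianization.of (f x)) := by
    rw [chainsToAbelianization_single]
    exact one_smul ℤ _
  rw [h1]
  rw [← Abelianization.ker_of, MonoidHom.mem_ker, map_mul, map_inv, mul_inv_eq_one] at hx
  rw [← hx]
  exact (congrArg Additive.ofMul hy').symm

end IntHomology

/-! ### The fiber product and its first homology. -/

section FiberProduct

theorem map_mem_commutator {G H : Type*} [Group G] [Group H] (f : G →* H) {x : G}
    (hx : x ∈ commutator G) : f x ∈ commutator H :=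
  (map_commutator_eq G f).le.trans (Subgroup.commutator_mono le_top le_top) ⟨_, hx, rfl⟩

variable {F Q : Type u} [Group F] [Group Q] (p : F →* Q)

theorem mem_fiberProduct {x : F × F} : x ∈ fiberProduct p ↔ p x.1 = p x.2 := Iff.rfl

/-- `[F, F]` maps onto `[Q, Q] = Q`, so `F = (ker p)[F, F]`. -/
theorem exists_mem_ker_mul_inv_mem_commutator (hQ : commutator Q = ⊤) (x : F)
    (hp : Function.Surjective p) : ∃ r ∈ p.ker, x * r⁻¹ ∈ commutator F := by
  have h : p x ∈ (commutator F).map p := by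
    rw [map_commutator_eq, MonoidHom.range_eq_top.2 hp]
    exact hQ.ge (Subgroup.mem_top _)
  obtain ⟨c, hc, hcx⟩ := h
  refine ⟨c⁻¹ * x, by simp [MonoidHom.mem_ker, hcx], ?_⟩
  simpa using hc

/-- The homomorphism `ker p × ker p → F ×_Q F`. -/
def kerProdToFiberProduct : p.ker × p.ker →* fiberProduct p :=
  (p.ker.subtype.prodMap p.ker.subtype).codRestrict (fiberProduct p) fun x =>
    (mem_fiberProduct p).2 (x.1.2.trans x.2.2.symm)

/-- The homomorphism `ker p → F ×_Q F` to the first factor. -/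
def kerToFiberProduct : p.ker →* fiberProduct p :=
  (kerProdToFiberProduct p).comp (MonoidHom.inl _ _)

/-- The diagonal homomorphism `F → F ×_Q F`. -/
def diagToFiberProduct : F →* fiberProduct p :=
  ((MonoidHom.id F).prod (MonoidHom.id F)).codRestrict (fiberProduct p) fun _ => rfl

theorem intHomologyMap_fiberProduct_one_bijective (hp : Function.Surjective p)
    (hQ : IsSuperPerfect Q) :
    Function.Bijective (intHomologyMap (fiberProduct p).subtype 1).hom := by
  have hperf := commutator_eq_top_of_subsingleton hQ.1
  constructor
  · refine intHomologyMap_one_injective _ fun ⟨⟨x, y⟩, hxy⟩ h => ?_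
    change ((x, y) : F × F) ∈ commutator (F × F) at h
    have hx : x ∈ commutator F :=
      map_mem_commutator (MonoidHom.fst F F) h
    have hy : y ∈ commutator F :=
      map_mem_commutator (MonoidHom.snd F F) h
    have hdiag : diagToFiberProduct p y ∈ commutator (fiberProduct p) :=
      map_mem_commutator (diagToFiberProduct p) hy
    have hk : x * y⁻¹ ∈ p.ker := by
      rw [MonoidHom.mem_ker, map_mul, map_inv, mul_inv_eq_one]
      exact hxy
    have hr := mem_commutator_ker_of_mem_commutator p hp
      (cycles₂_le_boundaries₂_of_subsingleton _ hQ.2) hk (mul_mem hx (inv_mem hy))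
    -- Uses `([f, r], 1) = [(f, f), (r, 1)]`, a commutator of elements of the fiber product.
    have hle : ⁅(⊤ : Subgroup F), p.ker⁆ ≤
        ((commutator (fiberProduct p)).comap (kerToFiberProduct p)).map p.ker.subtype := by
      rw [Subgroup.commutator_le]
      intro f _ r hr
      refine ⟨⟨f * r * f⁻¹ * r⁻¹, ?_⟩, ?_, rfl⟩
      · simp [MonoidHom.mem_ker, show p r = 1 from hr]
      · have := Subgroup.commutator_mem_commutator (Subgroup.mem_top (diagToFiberProduct p f))
          (Subgroup.mem_top (kerToFiberProduct p ⟨r, hr⟩))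
        refine (congrArg (· ∈ commutator (fiberProduct p)) (Subtype.ext (Prod.ext ?_ ?_))).mp this
        · rfl
        · change f * 1 * f⁻¹ * 1⁻¹ = 1
          group
    obtain ⟨r, hr, e⟩ := hle hr
    have : (⟨(x, y), hxy⟩ : fiberProduct p) = kerToFiberProduct p r * diagToFiberProduct p y := by
      refine Subtype.ext (Prod.ext ?_ ?_)
      · change x = p.ker.subtype r * y
        rw [e, inv_mul_cancel_right]
      · exact (one_mul y).symm
    rw [this]
    exact mul_mem hr hdiag
  · refine intHomologyMap_one_surjective _ fun ⟨x, y⟩ => ?_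
    obtain ⟨r, hr, hxr⟩ := exists_mem_ker_mul_inv_mem_commutator p hperf x hp
    obtain ⟨s, hs, hys⟩ := exists_mem_ker_mul_inv_mem_commutator p hperf y hp
    refine ⟨kerProdToFiberProduct p (⟨r, hr⟩, ⟨s, hs⟩), ?_⟩
    have hl : MonoidHom.inl F F (x * r⁻¹) ∈ commutator (F × F) :=
      map_mem_commutator (MonoidHom.inl F F) hxr
    have hr : MonoidHom.inr F F (y * s⁻¹) ∈ commutator (F × F) :=
      map_mem_commutator (MonoidHom.inr F F) hys
    convert mul_mem hl hr using 1
    refine Prod.ext ?_ ?_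
    · exact (mul_one _).symm
    · exact (one_mul _).symm

end FiberProduct

/-! ### Tori of the kernel and the second homology of the fiber product. -/

section KernelTori

variable {k F Q : Type u} [CommRing k] [Group F] [Group Q] (p : F →* Q)

/-- The torus `[(r, 1)|(1, s)] - [(1, s)|(r, 1)]` in `F ×_Q F`, for `r` and `s` in the kernel. -/
noncomputable def kernelTorus (k : Type u) [CommRing k] (x : p.ker × p.ker) :
    fiberProduct p × fiberProduct p →₀ k :=
  single (kerProdToFiberProduct p (x.1, 1), kerProdToFiberProduct p (1, x.2)) 1 -
    single (kerProdToFiberProduct p (1, x.2), kerProdToFiberProduct p (x.1, 1)) 1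

theorem kernelTorus_mem_cycles₂ (x : p.ker × p.ker) :
    kernelTorus p k x ∈ cycles₂ (trivialRep k (fiberProduct p)) := by
  change bd₂₁ k _ _ = 0
  rw [kernelTorus, map_sub, bd₂₁_single, bd₂₁_single, ← map_mul, ← map_mul]
  simp only [Prod.mk_mul_mk, one_mul, mul_one]
  abel

theorem toOpcycles₂_map_kernelTorus (x : p.ker × p.ker) :
    toOpcycles₂ k (F × F) (lmapDomain k k
      (Prod.map (fiberProduct p).subtype (fiberProduct p).subtype) (kernelTorus p k x)) =
    torusClass k ((x.1, 1) : F × F) (1, x.2) := by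
  rw [kernelTorus, map_sub, map_sub, lmapDomain_apply, lmapDomain_apply, mapDomain_single,
    mapDomain_single]
  rfl

/-- If `F` is free and `Q` is perfect, the tori of the kernel generate `H₂(F × F)`. -/
theorem exists_mem_span_kernelTorus [IsFreeGroup F] (hp : Function.Surjective p)
    (hQ : commutator Q = ⊤) {c : (F × F) × (F × F) →₀ k}
    (hc : c ∈ cycles₂ (trivialRep k (F × F))) :
    ∃ e ∈ Submodule.span k (Set.range (kernelTorus p k)),
      lmapDomain k k (Prod.map (fiberProduct p).subtype (fiberProduct p).subtype) e - c ∈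
        boundaries₂ (trivialRep k (F × F)) := by
  let Φ : (fiberProduct p × fiberProduct p →₀ k) →ₗ[k] Opcycles₂ k (F × F) :=
    toOpcycles₂ k (F × F) ∘ₗ
      lmapDomain k k (Prod.map (fiberProduct p).subtype (fiberProduct p).subtype)
  have hle : Submodule.span k
      (Set.range fun x : F × F => torusClass k ((x.1, 1) : F × F) (1, x.2)) ≤
      (Submodule.span k (Set.range (kernelTorus p k))).map Φ := by
    rw [Submodule.span_le]
    rintro _ ⟨⟨x, y⟩, rfl⟩
    obtain ⟨r, hr, hxr⟩ := exists_mem_ker_mul_inv_mem_commutator p hQ x hp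
    obtain ⟨s, hs, hys⟩ := exists_mem_ker_mul_inv_mem_commutator p hQ y hp
    refine ⟨_, Submodule.subset_span ⟨(⟨r, hr⟩, ⟨s, hs⟩), rfl⟩, ?_⟩
    refine (toOpcycles₂_map_kernelTorus p _).trans ?_
    exact ((torusClass_eq_of_mul_inv_mem_commutator_left y hxr).trans
      (torusClass_eq_of_mul_inv_mem_commutator_right r hys)).symm
  obtain ⟨e, he, h⟩ := hle (toOpcycles₂_mem_span_torusClass
    cycles₂_le_boundaries₂_of_isFreeGroup cycles₂_le_boundaries₂_of_isFreeGroup hc)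
  refine ⟨e, he, toOpcycles₂_eq_zero_iff.1 ?_⟩
  rw [map_sub, sub_eq_zero]
  exact h

theorem span_kernelTorus_le_cycles₂ :
    Submodule.span k (Set.range (kernelTorus p k)) ≤
      cycles₂ (trivialRep k (fiberProduct p)) := by
  rw [Submodule.span_le]
  rintro _ ⟨x, rfl⟩
  exact kernelTorus_mem_cycles₂ p x

theorem intHomologyMap_fiberProduct_two_surjective [IsFreeGroup F] (hp : Function.Surjective p)
    (hQ : commutator Q = ⊤) :
    Function.Surjective (intHomologyMap (fiberProduct p).subtype 2).hom := by
  intro z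
  obtain ⟨c, rfl⟩ := H2π_surjective _ z
  obtain ⟨e, he, h⟩ := exists_mem_span_kernelTorus p hp hQ c.2
  refine ⟨H2π _ ⟨e, span_kernelTorus_le_cycles₂ p he⟩, ?_⟩
  rw [intHomologyMap_H2π, H2π_eq_iff]
  exact h

/-- If `H₂(F ×_Q F) → H₂(F × F)` is injective, then `H₂(F ×_Q F)` is generated by the tori of the
kernel. -/
theorem exists_mem_span_kernelTorus_of_ker_eq_bot [IsFreeGroup F] (hp : Function.Surjective p)
    (hQ : commutator Q = ⊤)
    (hker : LinearMap.ker (intHomologyMap (fiberProduct p).subtype 2).hom = ⊥)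
    {c : fiberProduct p × fiberProduct p →₀ ULift.{u} ℤ}
    (hc : c ∈ cycles₂ (trivialInt (fiberProduct p))) :
    ∃ e ∈ Submodule.span (ULift.{u} ℤ) (Set.range (kernelTorus p (ULift.{u} ℤ))),
      e - c ∈ boundaries₂ (trivialInt (fiberProduct p)) := by
  obtain ⟨e, he, h⟩ := exists_mem_span_kernelTorus p hp hQ
    (mapDomain_mem_cycles₂ (fiberProduct p).subtype hc)
  refine ⟨e, he, (H2π_eq_iff ⟨e, span_kernelTorus_le_cycles₂ p he⟩ ⟨c, hc⟩).1 ?_⟩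
  apply LinearMap.ker_eq_bot.1 hker
  rw [intHomologyMap_H2π, intHomologyMap_H2π, H2π_eq_iff]
  exact h

end KernelTori

/-! ### Acyclicity of induced representations, and dimension shifting. -/

section InducedRep

variable (k G V : Type u) [CommRing k] [Group G] [AddCommGroup V] [Module k V]

/-- The representation `k[G] ⊗ V`, realised on finitely supported functions `G → V`. -/
noncomputable def inducedRepresentation : Representation k G (G →₀ V) where
  toFun g := lmapDomain V k (g * ·)
  map_one' := by ext; simp
  map_mul' g h := by ext; simp [mul_assoc]

/-- The representation `k[G] ⊗ V` as an object of the category of representations. -/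
noncomputable abbrev inducedRep : Rep.{u} k G := Rep.of (inducedRepresentation k G V)

variable {k G V}

@[simp]
theorem inducedRepresentation_single (g x : G) (v : V) :
    inducedRepresentation k G V g (single x v) = single (g * x) v := by
  simp [inducedRepresentation]

variable (k G V) in
/-- The contracting homotopy of the inhomogeneous chains of an induced representation. -/
noncomputable def inducedHomotopy (n : ℕ) :
    ((Fin n → G) →₀ (G →₀ V)) →ₗ[k] ((Fin (n + 1) → G) →₀ (G →₀ V)) :=
  -- The zeroth face acts by the inverse of the first entry, so prepending `x⁻¹` to `single 1 v`
  -- gives back `single x v`.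
  lsum k fun g => lsum k fun x => lsingle (Fin.cons x⁻¹ g : Fin (n + 1) → G) ∘ₗ lsingle 1

theorem inducedHomotopy_single (n : ℕ) (g : Fin n → G) (x : G) (v : V) :
    inducedHomotopy k G V n (single g (single x v)) =
      single (Fin.cons x⁻¹ g : Fin (n + 1) → G) (single 1 v) := by
  rw [inducedHomotopy, lsum_single, lsum_single]
  rfl

theorem Fin.contractNth_zero_cons {α : Type*} (op : α → α → α) {n : ℕ} (a : α)
    (g : Fin (n + 1) → α) :
    Fin.contractNth 0 op (Fin.cons a g : Fin (n + 2) → α) =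
      Fin.cons (op a (g 0)) (fun i => g i.succ) := by
  funext i
  refine Fin.cases ?_ (fun i => ?_) i <;> simp [Fin.contractNth]

theorem Fin.contractNth_succ_cons {α : Type*} (op : α → α → α) {n : ℕ} (j : Fin (n + 1)) (a : α)
    (g : Fin (n + 1) → α) :
    Fin.contractNth j.succ op (Fin.cons a g : Fin (n + 2) → α) =
      Fin.cons a (Fin.contractNth j op g) := by
  funext i
  refine Fin.cases ?_ (fun i => ?_) i
  · simp [Fin.contractNth]
  · simp [Fin.contractNth]

/-- The zeroth face of the homotopy is the original chain; the other faces are, with opposite sign,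
the homotopy of its faces. -/
theorem d_inducedHomotopy (n : ℕ) (c : (Fin (n + 1) → G) →₀ (G →₀ V)) :
    (inhomogeneousChains.d (inducedRep k G V) (n + 1)).hom (inducedHomotopy k G V (n + 1) c) =
      c - inducedHomotopy k G V n ((inhomogeneousChains.d (inducedRep k G V) n).hom c) := by
  have key : (inhomogeneousChains.d (inducedRep k G V) (n + 1)).hom ∘ₗ
      inducedHomotopy k G V (n + 1) = LinearMap.id - inducedHomotopy k G V n ∘ₗ
        (inhomogeneousChains.d (inducedRep k G V) n).hom := by
    refine lhom_ext' fun g => lhom_ext fun x v => ?_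
    simp only [LinearMap.comp_apply, LinearMap.sub_apply, LinearMap.id_apply, lsingle_apply]
    have h1 := inhomogeneousChains.d_single (A := inducedRep k G V) (n + 1)
      (Fin.cons x⁻¹ g : Fin (n + 2) → G) (single 1 v)
    have h2 := inhomogeneousChains.d_single (A := inducedRep k G V) n g (single x v)
    rw [inducedHomotopy_single]
    refine h1.trans ?_
    rw [eq_sub_iff_add_eq]
    refine (congrArg (_ + inducedHomotopy k G V n ·) h2).trans ?_
    rw [map_add, map_sum, Fin.sum_univ_succ]
    simp only [map_smul, inducedHomotopy_single, inducedRepresentation_single,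
      Fin.contractNth_zero_cons, Fin.contractNth_succ_cons, Fin.cons_zero, Fin.cons_succ, inv_inv,
      mul_one, mul_inv_rev, Fin.val_zero, zero_add, pow_one, Fin.val_succ, neg_smul, one_smul]
    simp only [pow_succ (-1 : k) (_ + 1), mul_neg, mul_one, neg_smul, Finset.sum_neg_distrib]
    abel
  exact LinearMap.congr_fun key c

/-- Induced representations have no higher homology. -/
theorem isZero_groupHomology_inducedRep (n : ℕ) :
    Limits.IsZero (groupHomology (inducedRep k G V) (n + 1)) := by
  refine (HomologicalComplex.exactAt_iff_isZero_homology _ _).1 ?_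
  rw [HomologicalComplex.exactAt_iff' _ (n + 2) (n + 1) n (by simp) (by simp),
    ShortComplex.moduleCat_exact_iff]
  intro c hc
  change ((inhomogeneousChains (inducedRep k G V)).d (n + 1) n).hom c = 0 at hc
  rw [inhomogeneousChains.d_def] at hc
  refine ⟨inducedHomotopy k G V (n + 1) c, ?_⟩
  change ((inhomogeneousChains (inducedRep k G V)).d (n + 2) (n + 1)).hom _ = c
  rw [inhomogeneousChains.d_def]
  refine (d_inducedHomotopy n c).trans ?_
  rw [hc, map_zero]
  exact sub_zero _

/-- The morphism `k[G] ⊗ V → A` extending a linear map on `V`. -/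
noncomputable def inducedRepLift (A : Rep.{u} k G) (f : V →ₗ[k] A) : inducedRep k G V ⟶ A :=
  Rep.ofHom ⟨lsum k fun g => A.ρ g ∘ₗ f, fun g => by
    refine lhom_ext fun x v => ?_
    simp⟩

@[simp]
theorem inducedRepLift_single (A : Rep.{u} k G) (f : V →ₗ[k] A) (g : G) (v : V) :
    (inducedRepLift A f).hom (single g v) = A.ρ g (f v) := by
  change lsum k (fun g => A.ρ g ∘ₗ f) (single g v) = _
  simp

end InducedRep

section KernelRep

variable {k G : Type u} [CommRing k] [Group G] {A B : Rep.{u} k G}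

theorem ker_le_comap_ker (φ : A ⟶ B) (g : G) :
    LinearMap.ker φ.hom.toLinearMap ≤ (LinearMap.ker φ.hom.toLinearMap).comap (A.ρ g) := by
  intro a ha
  have := Rep.hom_comm_apply φ g a
  rw [show φ.hom a = 0 from ha, map_zero] at this
  exact this

/-- The kernel of a morphism of representations. -/
noncomputable abbrev kernelRep (φ : A ⟶ B) : Rep.{u} k G :=
  A.subrepresentation (LinearMap.ker φ.hom.toLinearMap) (ker_le_comap_ker φ)

/-- Dimension shifting along a surjection from an acyclic representation. -/
theorem subsingleton_groupHomology_succ_of_kernelRep (φ : A ⟶ B)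
    (hφ : Function.Surjective φ.hom) (n : ℕ)
    (hA : Limits.IsZero (groupHomology A (n + 1)))
    (hK : Subsingleton (groupHomology (kernelRep φ) n)) :
    Subsingleton (groupHomology B (n + 1)) := by
  let ι : kernelRep φ ⟶ A := A.subtype _ _
  let S : ShortComplex (Rep.{u} k G) := ShortComplex.mk ι φ (by
    ext x
    exact x.2)
  have hS : S.ShortExact :=
    { exact := by
        rw [← ShortComplex.exact_map_iff_of_faithful S (forget₂ (Rep k G) (ModuleCat k)),
          ShortComplex.moduleCat_exact_iff]
        intro x hx
        exact ⟨⟨x, hx⟩, rfl⟩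
      mono_f := (Rep.mono_iff_injective _).2 Subtype.val_injective
      epi_g := (Rep.epi_iff_surjective _).2 hφ }
  -- The connecting map embeds `Hₙ₊₁(B)` in `Hₙ` of the kernel.
  have := mono_δ_of_isZero hS n hA
  exact ((ModuleCat.mono_iff_injective _).1 this).subsingleton

end KernelRep

/-! ### Fox calculus and the relation module. -/

section FoxDerivative

variable (k : Type u) {F Q : Type u} [CommRing k] [Group F] [Group Q] [IsFreeGroup F]
  (p : F →* Q)

/-- The free `k[Q]`-module on the generators of `F`. -/
noncomputable abbrev generatorRep : Rep.{u} k Q :=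
  inducedRep k Q (IsFreeGroup.Generators F →₀ k)

/-- A derivation is a cochain bounding the zero cocycle. -/
theorem exists_foxDerivative : ∃ D : F → (Q →₀ IsFreeGroup.Generators F →₀ k),
    (∀ i, D (IsFreeGroup.of i) = single 1 (single i 1)) ∧
    ∀ x y, D (x * y) = D x + inducedRepresentation k Q _ (p x) (D y) := by
  obtain ⟨D, h1, h2⟩ := IsFreeGroup.exists_cochain
    ((inducedRepresentation k Q (IsFreeGroup.Generators F →₀ k)).comp p) (fun _ _ => 0)
    (by simp) fun i => single 1 (single i 1)
  exact ⟨D, h1, fun x y => by simpa using h2 x y⟩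

/-- The Fox derivative `F → k[Q]^X`, where `X` is the set of generators of `F`. -/
noncomputable def foxDerivative (x : F) : Q →₀ IsFreeGroup.Generators F →₀ k :=
  (exists_foxDerivative k p).choose x

theorem foxDerivative_of (i : IsFreeGroup.Generators F) :
    foxDerivative k p (IsFreeGroup.of i) = single 1 (single i 1) :=
  (exists_foxDerivative k p).choose_spec.1 i

theorem foxDerivative_mul (x y : F) : foxDerivative k p (x * y) =
    foxDerivative k p x + inducedRepresentation k Q _ (p x) (foxDerivative k p y) :=
  (exists_foxDerivative k p).choose_spec.2 x y

theorem foxDerivative_one : foxDerivative k p (1 : F) = 0 := by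
  have := foxDerivative_mul k p 1 1
  simpa using this

theorem foxDerivative_inv (x : F) : foxDerivative k p x⁻¹ =
    -inducedRepresentation k Q _ (p x)⁻¹ (foxDerivative k p x) := by
  have := foxDerivative_mul k p x⁻¹ x
  rw [inv_mul_cancel, foxDerivative_one, map_inv] at this
  exact (eq_neg_iff_add_eq_zero (G := Q →₀ IsFreeGroup.Generators F →₀ k)).2 this.symm

/-- The augmentation `k[Q] → k`. -/
noncomputable def augmentation (Q : Type u) [Group Q] : inducedRep k Q k ⟶ trivialRep k Q :=
  inducedRepLift _ LinearMap.id

theorem augmentation_single (q : Q) (a : k) : (augmentation k Q).hom (single q a) = a :=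
  inducedRepLift_single (trivialRep k Q) LinearMap.id q a

/-- The augmentation ideal of `k[Q]`. -/
noncomputable abbrev augmentationRep (Q : Type u) [Group Q] : Rep.{u} k Q :=
  kernelRep (augmentation k Q)

/-- The element `q - 1` of the augmentation ideal. -/
noncomputable def subOne (q : Q) : augmentationRep k Q :=
  ⟨single q 1 - single 1 1, by
    rw [LinearMap.mem_ker, map_sub, sub_eq_zero]
    exact (augmentation_single k q 1).trans (augmentation_single k 1 1).symm⟩

theorem subOne_mul (x y : Q) :
    subOne k (x * y) = subOne k x + (augmentationRep k Q).ρ x (subOne k y) := by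
  refine Subtype.ext ?_
  change single (x * y) 1 - single 1 1 = (single x 1 - single 1 1) +
    inducedRepresentation k Q k x (single y 1 - single 1 1)
  rw [map_sub, inducedRepresentation_single, inducedRepresentation_single, mul_one]
  abel

/-- The map from the free module on the generators of `F` to the augmentation ideal. -/
noncomputable def generatorMap : generatorRep k (F := F) (Q := Q) ⟶ augmentationRep k Q :=
  inducedRepLift _ (linearCombination k fun i => subOne k (p (IsFreeGroup.of i)))

theorem generatorMap_single (q : Q) (i : IsFreeGroup.Generators F) (a : k) :
    (generatorMap k p).hom (single q (single i a)) =
      (augmentationRep k Q).ρ q (a • subOne k (p (IsFreeGroup.of i))) := by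
  rw [generatorMap, inducedRepLift_single, linearCombination_single]

/-- The fundamental formula of Fox calculus: both sides are derivations in `x` which agree on the
generators. -/
theorem generatorMap_foxDerivative (x : F) :
    (generatorMap k p).hom (foxDerivative k p x) = subOne k (p x) := by
  have hx : x ∈ Subgroup.closure (Set.range (IsFreeGroup.of : IsFreeGroup.Generators F → F)) := by
    rw [IsFreeGroup.closure_range_of]
    trivial
  have hone : subOne k (1 : Q) = 0 := Subtype.ext (sub_self _)
  have hequiv (q : Q) (v : generatorRep k (F := F) (Q := Q)) :=
    Rep.hom_comm_apply (generatorMap k p) q v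
  induction hx using Subgroup.closure_induction with
  | mem x hx =>
    obtain ⟨i, rfl⟩ := hx
    rw [foxDerivative_of, generatorMap_single, map_one, one_smul]
    rfl
  | one => rw [foxDerivative_one, map_zero, map_one, hone]
  | mul x y _ _ hx hy =>
    rw [foxDerivative_mul, map_add, map_mul, subOne_mul, hx, ← hy]
    exact congrArg _ (hequiv _ _)
  | inv x _ hx =>
    have h := subOne_mul k (p x)⁻¹ (p x)
    rw [inv_mul_cancel, hone] at h
    rw [foxDerivative_inv, map_neg, map_inv p x, eq_neg_of_add_eq_zero_left h.symm, ← hx]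
    exact congrArg _ (hequiv _ _)

/-- The relation module: the kernel of `k[Q]^X → k[Q]`. -/
noncomputable abbrev relationRep : Rep.{u} k Q := kernelRep (generatorMap k p)

/-- The difference of Fox derivatives, as a derivation of `F ×_Q F` in the relation module. -/
noncomputable def fiberDerivation (x : fiberProduct p) : relationRep k p :=
  ⟨foxDerivative k p x.1.1 - foxDerivative k p x.1.2, by
    change (generatorMap k p).hom _ = 0
    rw [map_sub, generatorMap_foxDerivative, generatorMap_foxDerivative, sub_eq_zero]
    exact congrArg _ x.2⟩

/-- The projection `F ×_Q F → Q`. -/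
def fiberProductToBase : fiberProduct p →* Q :=
  (p.comp (MonoidHom.fst F F)).comp (fiberProduct p).subtype

theorem fiberDerivation_mul (x y : fiberProduct p) : fiberDerivation k p (x * y) =
    fiberDerivation k p x + (relationRep k p).ρ (fiberProductToBase p x)
      (fiberDerivation k p y) := by
  refine Subtype.ext ?_
  change foxDerivative k p (x.1.1 * y.1.1) - foxDerivative k p (x.1.2 * y.1.2) =
    (foxDerivative k p x.1.1 - foxDerivative k p x.1.2) +
      inducedRepresentation k Q _ (p x.1.1) (foxDerivative k p y.1.1 - foxDerivative k p y.1.2)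
  rw [foxDerivative_mul, foxDerivative_mul, map_sub, ← show p x.1.1 = p x.1.2 from x.2]
  abel

theorem fiberDerivation_diag (x : F) : fiberDerivation k p (diagToFiberProduct p x) = 0 :=
  Subtype.ext (sub_self _)

theorem fiberDerivation_ker (r : p.ker) :
    (fiberDerivation k p (kerToFiberProduct p r)).1 = foxDerivative k p (r : F) := by
  change foxDerivative k p (r : F) - foxDerivative k p 1 = _
  rw [foxDerivative_one]
  exact sub_zero (G := Q →₀ IsFreeGroup.Generators F →₀ k) _

/-- The map from `1`-chains of the kernel to the relation module. -/
noncomputable def kerChainsToRelation : (p.ker →₀ k) →ₗ[k] relationRep k p :=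
  linearCombination k fun r => fiberDerivation k p (kerToFiberProduct p r)

theorem kerChainsToRelation_single (r : p.ker) (a : k) :
    (kerChainsToRelation k p (single r a)).1 = a • foxDerivative k p (r : F) := by
  rw [kerChainsToRelation, linearCombination_single, ← fiberDerivation_ker]
  rfl

end FoxDerivative

/-! ### Schreier elements, and the relation module as `H₁(ker p)`. -/

section Schreier

variable {F Q : Type u} [Group F] [Group Q] {p : F →* Q} (hp : Function.Surjective p)

/-- The Schreier element `s(q) x s(q p(x))⁻¹` of the kernel. -/
noncomputable def schreier (q : Q) (x : F) : p.ker :=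
  ⟨Function.surjInv hp q * x * (Function.surjInv hp (q * p x))⁻¹, by
    simp [MonoidHom.mem_ker, Function.surjInv_eq hp]⟩

theorem schreier_mul (q : Q) (x y : F) :
    schreier hp q (x * y) = schreier hp q x * schreier hp (q * p x) y := by
  refine Subtype.ext ?_
  change Function.surjInv hp q * (x * y) * (Function.surjInv hp (q * p (x * y)))⁻¹ =
    Function.surjInv hp q * x * (Function.surjInv hp (q * p x))⁻¹ *
      (Function.surjInv hp (q * p x) * y * (Function.surjInv hp (q * p x * p y))⁻¹)
  rw [map_mul, mul_assoc q]
  group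

end Schreier

section RelationModule

variable (k : Type u) {F Q : Type u} [CommRing k] [Group F] [Group Q] [IsFreeGroup F]
  {p : F →* Q} (hp : Function.Surjective p)

/-- The map `k[Q] → k[Q]^X` given by the Fox derivatives of a set-theoretic section of `p`. -/
noncomputable def sectionDerivative : (Q →₀ k) →ₗ[k] (Q →₀ IsFreeGroup.Generators F →₀ k) :=
  linearCombination k fun q => foxDerivative k p (Function.surjInv hp q)

/-- By the fundamental formula `q` goes to `q - 1`; on the augmentation ideal this is a linear
section of `generatorMap`. -/
theorem generatorMap_sectionDerivative (y : Q →₀ k) :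
    ((generatorMap k p).hom (sectionDerivative k hp y)).1 =
      y - single 1 ((augmentation k Q).hom y) := by
  induction y using Finsupp.induction_linear with
  | zero => simp
  | add x y hx hy =>
    rw [map_add, map_add, map_add, single_add]
    refine (congrArg₂ (· + ·) hx hy).trans ?_
    abel
  | single q a =>
    rw [augmentation_single, sectionDerivative, linearCombination_single, map_smul,
      generatorMap_foxDerivative, Function.surjInv_eq hp]
    change a • (single q 1 - single 1 1) = _
    rw [smul_sub, smul_single, smul_single, smul_eq_mul, mul_one]

theorem generatorMap_surjective (hp : Function.Surjective p) :
    Function.Surjective (generatorMap k p).hom := by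
  intro y
  refine ⟨sectionDerivative k hp y.1, Subtype.ext ?_⟩
  rw [generatorMap_sectionDerivative, show (augmentation k Q).hom y.1 = 0 from y.2, single_zero,
    sub_zero]

theorem augmentation_surjective : Function.Surjective (augmentation k Q).hom :=
  fun a => ⟨single 1 a, augmentation_single k 1 a⟩

/-- The map `k[Q]^X → H₁(ker p)` sending a basis element to the corresponding Schreier element. -/
noncomputable def generatorsToFirstHomology :
    (Q →₀ IsFreeGroup.Generators F →₀ k) →ₗ[k] (p.ker →₀ k) ⧸ boundaries₁ (trivialRep k p.ker) :=
  lsum k fun q => linearCombination k fun i => firstClass k (schreier hp q (IsFreeGroup.of i))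

theorem generatorsToFirstHomology_single (q : Q) (i : IsFreeGroup.Generators F) (a : k) :
    generatorsToFirstHomology k hp (single q (single i a)) =
      a • firstClass k (schreier hp q (IsFreeGroup.of i)) := by
  rw [generatorsToFirstHomology, lsum_single, linearCombination_single]

/-- Both sides obey the same product rule in `x`, on the right by `schreier_mul`, and agree on the
generators. -/
theorem generatorsToFirstHomology_foxDerivative (q : Q) (x : F) :
    generatorsToFirstHomology k hp (inducedRepresentation k Q _ q (foxDerivative k p x)) =
      firstClass k (schreier hp q x) := by
  have hx : x ∈ Subgroup.closure (Set.range (IsFreeGroup.of : IsFreeGroup.Generators F → F)) := by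
    rw [IsFreeGroup.closure_range_of]
    trivial
  have hone (q : Q) : firstClass k (schreier hp q 1) = 0 := by
    have := congrArg (firstClass k) (schreier_mul hp q 1 1)
    rwa [firstClass_mul, map_one, mul_one, mul_one, left_eq_add] at this
  induction hx using Subgroup.closure_induction generalizing q with
  | mem x hx =>
    obtain ⟨i, rfl⟩ := hx
    rw [foxDerivative_of, inducedRepresentation_single, mul_one,
      generatorsToFirstHomology_single, one_smul]
  | one => rw [foxDerivative_one, map_zero, map_zero, hone]
  | mul x y _ _ hx hy =>
    rw [foxDerivative_mul, map_add, map_add, hx, schreier_mul, firstClass_mul, ← hy, map_mul]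
    rfl
  | inv x _ hx =>
    have h := congrArg (firstClass k) (schreier_mul hp q x⁻¹ x)
    rw [inv_mul_cancel, hone, firstClass_mul, map_inv p x] at h
    rw [foxDerivative_inv, map_neg, map_neg, eq_neg_of_add_eq_zero_left h.symm, ← hx, map_mul]
    rfl

/-- This left inverse makes `H₁(ker p) → M` injective. -/
theorem generatorsToFirstHomology_kerChainsToRelation (c : p.ker →₀ k) :
    generatorsToFirstHomology k hp (kerChainsToRelation k p c).1 =
      (boundaries₁ (trivialRep k p.ker)).mkQ c := by
  induction c using Finsupp.induction_linear with
  | zero =>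
    rw [map_zero, map_zero]
    exact map_zero _
  | add x y hx hy =>
    rw [map_add, map_add, ← hx, ← hy]
    exact map_add (generatorsToFirstHomology k hp) _ _
  | single r a =>
    have h := generatorsToFirstHomology_foxDerivative k hp 1 (r : F)
    rw [map_one, Module.End.one_apply] at h
    -- The section need not send `1` to `1`, but conjugating by its value, an element of the kernel,
    -- does not change the class.
    have e : schreier hp 1 (r : F) = ⟨Function.surjInv hp 1, Function.surjInv_eq hp 1⟩ * r *
        ⟨Function.surjInv hp 1, Function.surjInv_eq hp 1⟩⁻¹ := by
      refine Subtype.ext ?_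
      change Function.surjInv hp 1 * (r : F) * (Function.surjInv hp (1 * p r))⁻¹ =
        Function.surjInv hp 1 * (r : F) * (Function.surjInv hp 1)⁻¹
      rw [show p r = 1 from r.2, mul_one]
    rw [kerChainsToRelation_single, map_smul, h, e, firstClass_mul, firstClass_mul,
      firstClass_inv, add_neg_cancel_comm, firstClass, ← map_smul, smul_single, smul_eq_mul,
      mul_one]

theorem mem_boundaries₁_of_kerChainsToRelation_eq_zero (hp : Function.Surjective p)
    {c : p.ker →₀ k} (hc : kerChainsToRelation k p c = 0) :
    c ∈ boundaries₁ (trivialRep k p.ker) := by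
  refine (Submodule.Quotient.mk_eq_zero _).1
    ((generatorsToFirstHomology_kerChainsToRelation k hp c).symm.trans ?_)
  rw [hc]
  exact map_zero _

theorem kerChainsToRelation_boundary (e : p.ker × p.ker →₀ k) :
    kerChainsToRelation k p (bd₂₁ k p.ker e) = 0 := by
  induction e using Finsupp.induction_linear with
  | zero => simp
  | add x y hx hy => rw [map_add, map_add, hx, hy, add_zero]
  | single x a =>
    obtain ⟨r, s⟩ := x
    rw [bd₂₁_single, map_add, map_sub]
    simp only [kerChainsToRelation, linearCombination_single, map_mul, fiberDerivation_mul]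
    rw [show fiberProductToBase p (kerToFiberProduct p r) = 1 from r.2, map_one,
      Module.End.one_apply, smul_add]
    abel

theorem foxDerivative_schreier (q : Q) (i : IsFreeGroup.Generators F) :
    foxDerivative k p (schreier hp q (IsFreeGroup.of i) : F) =
      foxDerivative k p (Function.surjInv hp q) + single q (single i 1) -
        foxDerivative k p (Function.surjInv hp (q * p (IsFreeGroup.of i))) := by
  change foxDerivative k p (Function.surjInv hp q * IsFreeGroup.of i *
    (Function.surjInv hp (q * p (IsFreeGroup.of i)))⁻¹) = _
  rw [foxDerivative_mul, foxDerivative_mul, foxDerivative_inv, foxDerivative_of, map_mul,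
    Function.surjInv_eq hp, Function.surjInv_eq hp, inducedRepresentation_single, mul_one,
    map_neg, Representation.self_inv_apply]
  exact (sub_eq_add_neg (G := Q →₀ IsFreeGroup.Generators F →₀ k) _ _).symm

theorem augmentationRep_smul_subOne (q x : Q) (a : k) :
    ((augmentationRep k Q).ρ q (a • subOne k x)).1 = a • (single (q * x) (1 : k) - single q 1) := by
  have h : inducedRepresentation k Q k q (single x 1 - single 1 1) =
      single (q * x) 1 - single q 1 := by
    rw [map_sub, inducedRepresentation_single, inducedRepresentation_single, mul_one]
  rw [map_smul]
  exact congrArg (a • ·) h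

theorem sectionDerivative_generatorMap_single (q : Q) (i : IsFreeGroup.Generators F) (a : k) :
    sectionDerivative k hp ((generatorMap k p).hom (single q (single i a))).1 =
      a • (foxDerivative k p (Function.surjInv hp (q * p (IsFreeGroup.of i))) -
        foxDerivative k p (Function.surjInv hp q)) := by
  rw [generatorMap_single, augmentationRep_smul_subOne, map_smul, map_sub]
  simp only [sectionDerivative, linearCombination_single, one_smul]

theorem kerChainsToRelation_surjective (hp : Function.Surjective p) :
    Function.Surjective (kerChainsToRelation k p) := by
  let Θ : ((p.ker →₀ k) ⧸ boundaries₁ (trivialRep k p.ker)) →ₗ[k] relationRep k p :=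
    (boundaries₁ (trivialRep k p.ker)).liftQ (kerChainsToRelation k p) (by
      rintro _ ⟨e, rfl⟩
      exact kerChainsToRelation_boundary k e)
  have hΘ (r : p.ker) : (Θ (firstClass k r)).1 = foxDerivative k p (r : F) :=
    (kerChainsToRelation_single k p r 1).trans (one_smul _ _)
  -- The correction term vanishes on the relation module, so `Θ` has a right inverse there.
  have key : (LinearMap.ker (generatorMap k p).hom.toLinearMap).subtype ∘ₗ Θ ∘ₗ
      generatorsToFirstHomology k hp = LinearMap.id - sectionDerivative k hp ∘ₗ
        (LinearMap.ker (augmentation k Q).hom.toLinearMap).subtype ∘ₗ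
          (generatorMap k p).hom.toLinearMap := by
    refine lhom_ext' fun q => lhom_ext fun i a => ?_
    change (Θ (generatorsToFirstHomology k hp (single q (single i a)))).1 =
      single q (single i a) -
        sectionDerivative k hp ((generatorMap k p).hom (single q (single i a))).1
    rw [generatorsToFirstHomology_single, map_smul, sectionDerivative_generatorMap_single]
    refine (congrArg (a • ·) ((hΘ _).trans (foxDerivative_schreier k hp q i))).trans ?_
    have h : (single q (single i a) : Q →₀ IsFreeGroup.Generators F →₀ k) =
        a • single q (single i 1) := by
      rw [smul_single, smul_single, smul_eq_mul, mul_one]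
    have halg {M : Type u} [AddCommGroup M] [Module k M] (x y z : M) :
        a • (x + y - z) = a • y - a • (z - x) := by module
    rw [h]
    exact halg (M := Q →₀ IsFreeGroup.Generators F →₀ k) _ _ _
  intro v
  obtain ⟨c, hc⟩ := Submodule.mkQ_surjective _ (generatorsToFirstHomology k hp v.1)
  refine ⟨c, Subtype.ext ?_⟩
  have h : (Θ (generatorsToFirstHomology k hp v.1)).1 =
      v.1 - sectionDerivative k hp ((generatorMap k p).hom v.1).1 := LinearMap.congr_fun key v.1
  rw [← hc, show (generatorMap k p).hom v.1 = 0 from v.2] at h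
  refine h.trans ?_
  change v.1 - sectionDerivative k hp 0 = v.1
  rw [map_zero]
  exact sub_zero (G := Q →₀ IsFreeGroup.Generators F →₀ k) _

end RelationModule

/-! ### The cap product with the derivation of the fiber product. -/

section CapProduct

/-- With `m` and `n` the values of the derivation at the last two entries, this is the cap product
of the boundary of a `3`-simplex. -/
theorem cap_boundary_mem_boundaries₁ {k G : Type u} [CommRing k] [Group G] {A : Rep.{u} k G}
    (x y : G) (m n : A) :
    single y (A.ρ y n) - single (x * y) (A.ρ (x * y) n) + single x (A.ρ x (m + A.ρ y n)) -
      single x (A.ρ x m) ∈ boundaries₁ A := by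
  refine ⟨single (x, y) (A.ρ (x * y) n), ?_⟩
  refine (d₂₁_single (A := A) (x, y) _).trans ?_
  rw [map_add, single_add, map_mul, Module.End.mul_apply, Representation.inv_self_apply]
  abel

variable (k : Type u) {F Q : Type u} [CommRing k] [Group F] [Group Q] [IsFreeGroup F]
  (p : F →* Q)

/-- The cap product of `2`-chains of `F ×_Q F` with the derivation in the relation module. -/
noncomputable def capDerivation :
    (fiberProduct p × fiberProduct p →₀ k) →ₗ[k] (Q →₀ relationRep k p) :=
  linearCombination k fun x => single (fiberProductToBase p x.1)
    ((relationRep k p).ρ (fiberProductToBase p x.1) (fiberDerivation k p x.2))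

theorem capDerivation_single (x y : fiberProduct p) (a : k) :
    capDerivation k p (single (x, y) a) = a • single (fiberProductToBase p x)
      ((relationRep k p).ρ (fiberProductToBase p x) (fiberDerivation k p y)) := by
  rw [capDerivation, linearCombination_single]

/-- A `1`-chain supported at `1` is a boundary. This kills both the tori of the kernel and the
chains coming from the kernel. -/
theorem capDerivation_single_mem_boundaries₁ {x : fiberProduct p}
    (hx : fiberProductToBase p x = 1) (y : fiberProduct p) (a : k) :
    capDerivation k p (single (x, y) a) ∈ boundaries₁ (relationRep k p) := by
  rw [capDerivation_single, hx]
  exact Submodule.smul_mem _ _ (single_one_mem_boundaries₁ _)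

theorem capDerivation_bd₃₂_mem_boundaries₁
    (e : fiberProduct p × fiberProduct p × fiberProduct p →₀ k) :
    capDerivation k p (bd₃₂ k _ e) ∈ boundaries₁ (relationRep k p) := by
  induction e using Finsupp.induction_linear with
  | zero => simp
  | add x y hx hy =>
    rw [map_add, map_add]
    exact add_mem hx hy
  | single x a =>
    obtain ⟨x, y, z⟩ := x
    rw [bd₃₂_single, map_sub, map_add, map_sub, capDerivation_single, capDerivation_single,
      capDerivation_single, capDerivation_single, ← smul_sub, ← smul_add, ← smul_sub,
      fiberDerivation_mul, map_mul]
    exact Submodule.smul_mem _ _ (cap_boundary_mem_boundaries₁ _ _ _ _)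

theorem capDerivation_mem_boundaries₁ {c : fiberProduct p × fiberProduct p →₀ k}
    (hc : c ∈ boundaries₂ (trivialRep k (fiberProduct p))) :
    capDerivation k p c ∈ boundaries₁ (relationRep k p) := by
  obtain ⟨e, rfl⟩ := hc
  exact capDerivation_bd₃₂_mem_boundaries₁ k p e

theorem capDerivation_kernelTorus_mem_boundaries₁ (x : p.ker × p.ker) :
    capDerivation k p (kernelTorus p k x) ∈ boundaries₁ (relationRep k p) := by
  rw [kernelTorus, map_sub]
  refine sub_mem (capDerivation_single_mem_boundaries₁ k p ?_ _ _)
    (capDerivation_single_mem_boundaries₁ k p ?_ _ _)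
  · exact x.1.2
  · exact map_one p

theorem capDerivation_kerChains_mem_boundaries₁ (e : p.ker × p.ker →₀ k) :
    capDerivation k p (lmapDomain k k (Prod.map (kerToFiberProduct p) (kerToFiberProduct p)) e) ∈
      boundaries₁ (relationRep k p) := by
  induction e using Finsupp.induction_linear with
  | zero => simp
  | add x y hx hy =>
    rw [map_add, map_add]
    exact add_mem hx hy
  | single x a =>
    rw [lmapDomain_apply, mapDomain_single]
    exact capDerivation_single_mem_boundaries₁ k p
      (show fiberProductToBase p (kerToFiberProduct p x.1) = 1 from x.1.2) _ _

end CapProduct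

/-! ### Conjugation chains and surjectivity of the cap product. -/

section ConjugationChains

variable (k : Type u) {F Q : Type u} [CommRing k] [Group F] [Group Q] (p : F →* Q)

/-- Conjugation `r ↦ f⁻¹ r f` on the kernel of `p`. -/
def kerConj (f : F) (r : p.ker) : p.ker :=
  ⟨f⁻¹ * r * f, by simp [MonoidHom.mem_ker, show p r = 1 from r.2]⟩

theorem diag_mul_ker_kerConj (f : F) (r : p.ker) :
    diagToFiberProduct p f * kerToFiberProduct p (kerConj p f r) =
      kerToFiberProduct p r * diagToFiberProduct p f := by
  refine Subtype.ext (Prod.ext ?_ ?_)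
  · change f * (f⁻¹ * r * f) = r * f
    group
  · change f * 1 = 1 * f
    rw [mul_one, one_mul]

/-- The `2`-chain `[f|r^f] - [r|f]` of `F ×_Q F`, extended linearly in `r`. -/
noncomputable def conjChain (f : F) :
    (p.ker →₀ k) →ₗ[k] (fiberProduct p × fiberProduct p →₀ k) :=
  linearCombination k fun r =>
    single (diagToFiberProduct p f, kerToFiberProduct p (kerConj p f r)) 1 -
      single (kerToFiberProduct p r, diagToFiberProduct p f) 1

/-- The product terms of the two simplices cancel, since `f · r^f = r · f`. -/
theorem bd₂₁_conjChain (f : F) (c : p.ker →₀ k) :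
    bd₂₁ k _ (conjChain k p f c) =
      lmapDomain k k (kerToFiberProduct p) (lmapDomain k k (kerConj p f) c - c) := by
  induction c using Finsupp.induction_linear with
  | zero => simp
  | add x y hx hy =>
    rw [map_add, map_add, hx, hy]
    simp only [map_add, map_sub]
    abel
  | single r a =>
    rw [conjChain, linearCombination_single, map_smul, map_sub, bd₂₁_single, bd₂₁_single,
      diag_mul_ker_kerConj, map_sub]
    simp only [lmapDomain_apply, mapDomain_single]
    rw [show single (kerToFiberProduct p (kerConj p f r)) a =
      a • single (kerToFiberProduct p (kerConj p f r)) (1 : k) by simp,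
      show single (kerToFiberProduct p r) a = a • single (kerToFiberProduct p r) (1 : k) by simp,
      ← smul_sub]
    congr 1
    abel

variable [IsFreeGroup F]

theorem relationRep_fiberDerivation_kerConj (f : F) (r : p.ker) :
    (relationRep k p).ρ (p f) (fiberDerivation k p (kerToFiberProduct p (kerConj p f r))) =
      fiberDerivation k p (kerToFiberProduct p r) := by
  have := congrArg (fiberDerivation k p) (diag_mul_ker_kerConj p f r)
  rw [fiberDerivation_mul, fiberDerivation_mul, fiberDerivation_diag, map_zero, add_zero,
    zero_add] at this
  exact this

theorem kerChainsToRelation_kerConj (f : F) (c : p.ker →₀ k) :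
    kerChainsToRelation k p (lmapDomain k k (kerConj p f) c) =
      (relationRep k p).ρ (p f)⁻¹ (kerChainsToRelation k p c) := by
  induction c using Finsupp.induction_linear with
  | zero => simp
  | add x y hx hy => simp only [map_add, hx, hy]
  | single r a =>
    rw [lmapDomain_apply, mapDomain_single]
    simp only [kerChainsToRelation, linearCombination_single]
    rw [map_smul, ← relationRep_fiberDerivation_kerConj k p f r, Representation.inv_self_apply]

/-- The simplex ending in a diagonal element contributes nothing, as the derivation vanishes there.
Conjugation chains thus lift every `1`-chain of `Q` in `M`. -/
theorem capDerivation_conjChain (f : F) (c : p.ker →₀ k) :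
    capDerivation k p (conjChain k p f c) = single (p f) (kerChainsToRelation k p c) := by
  induction c using Finsupp.induction_linear with
  | zero => simp
  | add x y hx hy => simp only [map_add, hx, hy, single_add]
  | single r a =>
    rw [conjChain, linearCombination_single, map_smul, map_sub, capDerivation_single,
      capDerivation_single, fiberDerivation_diag, map_zero, single_zero, smul_zero, sub_zero,
      one_smul, kerChainsToRelation, linearCombination_single, ← smul_single]
    exact congrArg (a • single (p f) ·) (relationRep_fiberDerivation_kerConj k p f r)

/-- If `H₂(F ×_Q F)` is generated by the tori of the kernel, then the first homology of `Q` in the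
relation module vanishes. -/
theorem subsingleton_groupHomology_relationRep (hp : Function.Surjective p)
    (h : ∀ c ∈ cycles₂ (trivialRep k (fiberProduct p)),
      ∃ e ∈ Submodule.span k (Set.range (kernelTorus p k)),
        e - c ∈ boundaries₂ (trivialRep k (fiberProduct p))) :
    Subsingleton (groupHomology (relationRep k p) 1) := by
  refine subsingleton_of_forall_eq 0 fun y => ?_
  obtain ⟨z, rfl⟩ := H1π_surjective _ y
  refine (H1π_eq_zero_iff z).2 ?_
  obtain ⟨z, hz⟩ := z
  change z ∈ boundaries₁ (relationRep k p)
  let s : Q → F := Function.surjInv hp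
  have hs (q : Q) : p (s q) = q := Function.surjInv_eq hp q
  obtain ⟨l, hl⟩ := (kerChainsToRelation_surjective k hp).hasRightInverse
  let t : fiberProduct p × fiberProduct p →₀ k := z.sum fun q m => conjChain k p (s q) (l m)
  let w : p.ker →₀ k := z.sum fun q m => lmapDomain k k (kerConj p (s q)) (l m) - l m
  have ht : bd₂₁ k _ t = lmapDomain k k (kerToFiberProduct p) w := by
    simp only [t, w, Finsupp.sum, map_sum, bd₂₁_conjChain]
  -- The cycle condition on `z` says that `w` vanishes in `M`, and `H₁(ker p) → M` is injective.
  have hw : w ∈ boundaries₁ (trivialRep k p.ker) := by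
    refine mem_boundaries₁_of_kerChainsToRelation_eq_zero k hp ?_
    rw [← sub_eq_zero.2 ((mem_cycles₁_iff z).1 hz), ← Finsupp.sum_sub, map_finsuppSum]
    refine Finsupp.sum_congr fun q _ => ?_
    rw [map_sub, kerChainsToRelation_kerConj, hs, hl]
  obtain ⟨e, he⟩ := hw
  change bd₂₁ k _ e = w at he
  have hcap : capDerivation k p t = z := by
    rw [map_finsuppSum]
    refine (Finsupp.sum_congr fun q _ => ?_).trans z.sum_single
    rw [capDerivation_conjChain, hs, hl]
  -- Subtracting `e` closes `t` up to a cycle without changing its cap product modulo boundaries.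
  obtain ⟨e', he', hb⟩ := h
    (t - lmapDomain k k (Prod.map (kerToFiberProduct p) (kerToFiberProduct p)) e) (by
      change bd₂₁ k _ _ = 0
      rw [map_sub, bd₂₁_mapDomain, ht, he, sub_self])
  have h1 := capDerivation_mem_boundaries₁ k p hb
  have h2 : capDerivation k p e' ∈ boundaries₁ (relationRep k p) := by
    have hle : Submodule.span k (Set.range (kernelTorus p k)) ≤
        (boundaries₁ (relationRep k p)).comap (capDerivation k p) := by
      rw [Submodule.span_le]
      rintro _ ⟨x, rfl⟩
      exact capDerivation_kernelTorus_mem_boundaries₁ k p x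
    exact hle he'
  have h3 := capDerivation_kerChains_mem_boundaries₁ k p e
  rw [map_sub, map_sub, hcap] at h1
  have h4 := add_mem (sub_mem h2 h1) h3
  convert h4 using 1
  abel

end ConjugationChains

theorem mainTheorem2 {F Q : Type u} [Group F] [Group Q] [IsFreeGroup F]
    (p : F →* Q) (hp : Function.Surjective p) (hQ : IsSuperPerfect Q) :
    IsHomologicallyTwoConnected (fiberProduct p).subtype ∧
      (LinearMap.ker (intHomologyMap (fiberProduct p).subtype 2).hom = ⊥ →
        Subsingleton (intHomology Q 3)) := by
  have hperf := commutator_eq_top_of_subsingleton hQ.1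
  refine ⟨⟨intHomologyMap_fiberProduct_one_bijective p hp hQ,
    intHomologyMap_fiberProduct_two_surjective p hp hperf⟩, fun hker => ?_⟩
  have hrel := subsingleton_groupHomology_relationRep (ULift.{u} ℤ) p hp fun c hc =>
    exists_mem_span_kernelTorus_of_ker_eq_bot p hp hperf hker hc
  -- Two shifts: from `H₁` of the relation module to `H₂` of the augmentation ideal, then to
  -- `H₃(Q)`.
  have haug := subsingleton_groupHomology_succ_of_kernelRep (generatorMap (ULift.{u} ℤ) p)
    (generatorMap_surjective _ hp) 1 (isZero_groupHomology_inducedRep 1) hrel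
  exact subsingleton_groupHomology_succ_of_kernelRep (augmentation (ULift.{u} ℤ) Q)
    (augmentation_surjective _) 2 (isZero_groupHomology_inducedRep 2) haug
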